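/- Let $k$ be a field, $H$ a finite-dimensional Hopf algebra over $k$, $R$ an associative unital $k$-algebra, and $R\#_\sigma H$ a crossed product. That is, $H$ measures $R$ via $h\otimes r\mapsto h\cdot r$ (so $h\cdot(ab)=\sum(h_1\cdot a)(h_2\cdot b)$, $h\cdot 1=\varepsilon(h)1$) with $1\cdot a=a$, and $\sigma:H\otimes H\to R$ is a convolution-invertible linear map with $\sigma(h,1)=\sigma(1,h)=\varepsilon(h)1$, $$h\cdot(l\cdot a)=\sum\sigma(h_1,l_1)\,(h_2l_2\cdot a)\,\sigma^{-1}(h_3,l_3),\qquad \sum (h_1\cdot\sigma(l_1,m_1))\,\sigma(h_2,l_2m_2)=\sum\sigma(h_1,l_1)\,\sigma(h_2l_2,m)$$ for $h,l,m\in H$, $a\in R$. Then $R\#_\sigma H$ is the vector space $R\otimes H$ with $(a\#h)(b\#l)=\sum a(h_1\cdot b)\sigma(h_2,l_1)\#h_3l_2$; it contains $R$ as $R\#1$, and the dual $H^*$ acts on it by $\varphi\cdot(r\#h)=\sum r\#\varphi(h_2)h_1$. For $L=H$ acting on $A=R$, or $L=H^*$ acting on $A=R\#_\sigma H$, an $L$-ideal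 of $A$ is a two-sided ideal $I$ with $L\cdot I\subseteq I$. An $L$-ideal $I$ is $L$-semiprime if $J^2\subseteq I$ implies $J\subseteq I$ for every $L$-ideal $J$. The $L$-Baer radical $r_{Lb}(A)$ is the intersection of all $L$-semiprime ideals of $A$. The Baer radical $r_b(A)$ of a ring $A$ is the intersection of its prime ideals. For an ideal $I$ of $R$ put $(I:H)=\{x\in R\mid h\cdot x\in I\text{ for all }h\in H\}$, and for an $H$-ideal $I$ of $R$ let $I\#_\sigma H$ be the span of all $r\#h$ with $r\in I$, $h\in H$. Then 1. $r_{H^*b}(R\#_\sigma H)=r_{Hb}(R)\#_\sigma H$; 2. $r_{Hb}(R)=(r_b(R):H)=r_b(R\#_\sigma H)\cap R$. -/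

import Mathlib

open scoped TensorProduct
open Coalgebra WithConv

noncomputable section

/-! ### Convolution of an `R`-valued map with a module-valued map -/

namespace SweedlerConv

variable {k C D R V : Type*} [CommRing k] [Ring R] [Algebra k R]
  [AddCommGroup C] [Module k C] [Coalgebra k C] [AddCommGroup D] [Module k D] [Coalgebra k D]
  [AddCommGroup V] [Module k V] [Module R V] [IsScalarTower k R V]

/-- `convAct f v` is the map `c ↦ ∑ f(c₁) • v(c₂)`. It is bilinear in `f` and `v`. -/
def convAct : (C →ₗ[k] R) →ₗ[k] (C →ₗ[k] V) →ₗ[k] (C →ₗ[k] V) :=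
  LinearMap.mk₂ k
    (fun f v ↦ TensorProduct.lift (Algebra.lsmul k k V).toLinearMap ∘ₗ TensorProduct.map f v ∘ₗ comul)
    (fun f g v ↦ by simp [TensorProduct.map_add_left, LinearMap.add_comp, LinearMap.comp_add])
    (fun c f v ↦ by simp [TensorProduct.map_smul_left, LinearMap.smul_comp, LinearMap.comp_smul])
    (fun f v w ↦ by simp [TensorProduct.map_add_right, LinearMap.add_comp, LinearMap.comp_add])
    (fun c f v ↦ by simp [TensorProduct.map_smul_right, LinearMap.smul_comp, LinearMap.comp_smul])

theorem convAct_def (f : C →ₗ[k] R) (v : C →ₗ[k] V) (x : C) :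
    convAct f v x = TensorProduct.lift (Algebra.lsmul k k V).toLinearMap
      (TensorProduct.map f v (comul x)) := rfl

theorem convAct_apply {ι : Type*} (f : C →ₗ[k] R) (v : C →ₗ[k] V) {x : C} (r : Repr k x ι) :
    convAct f v x = ∑ i ∈ r.index, f (r.left i) • v (r.right i) := by
  simp [convAct_def, ← r.eq]

theorem convAct_comp (f : C →ₗ[k] R) (v : C →ₗ[k] V) (φ : D →ₗc[k] C) (x : D) :
    convAct f v (φ x) = convAct (f ∘ₗ φ.toLinearMap) (v ∘ₗ φ.toLinearMap) x := by
  rw [convAct_def, convAct_def, ← CoalgHomClass.map_comp_comul_apply, TensorProduct.map_comp]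
  rfl

theorem convAct_comp_eq (f : C →ₗ[k] R) (v : C →ₗ[k] V) (φ : D →ₗ[k] C) (ψ : D →ₗc[k] C)
    (h : ψ.toLinearMap = φ) : convAct f v ∘ₗ φ = convAct (f ∘ₗ φ) (v ∘ₗ φ) := by
  subst h
  exact LinearMap.ext fun x ↦ convAct_comp f v ψ x

theorem convAct_convAct (f g : C →ₗ[k] R) (v : C →ₗ[k] V) :
    convAct f (convAct g v) = convAct (toConv f * toConv g).ofConv v := by
  ext x
  have h := congrArg (TensorProduct.lift (Algebra.lsmul k k V).toLinearMap ∘ₗ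
    TensorProduct.map f (TensorProduct.lift (Algebra.lsmul k k V).toLinearMap ∘ₗ
      TensorProduct.map g v)) (coassoc_apply (R := k) x)
  have h2 : convAct f (convAct g v) x = (TensorProduct.lift (Algebra.lsmul k k V).toLinearMap ∘ₗ
    TensorProduct.map f (TensorProduct.lift (Algebra.lsmul k k V).toLinearMap ∘ₗ
      TensorProduct.map g v)) (comul.lTensor C (comul (R := k) x)) := by
    rw [convAct_def]
    generalize comul (R := k) x = t
    induction t with
    | zero => simp
    | add a b ha hb => simp only [map_add, ha, hb]
    | tmul a b => simp [convAct_def]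
  rw [h2, ← h, convAct_def]
  generalize comul (R := k) x = t
  induction t with
  | zero => simp
  | add a b ha hb => simp only [map_add, ha, hb]
  | tmul a b =>
    simp only [LinearMap.rTensor_tmul, TensorProduct.map_tmul, LinearMap.convMul_apply]
    generalize comul (R := k) a = s
    induction s with
    | zero => simp
    | add a b ha hb => simp only [map_add, TensorProduct.add_tmul, ha, hb]
    | tmul a b => simp

theorem convAct_counit (v : C →ₗ[k] V) :
    convAct (Algebra.linearMap k R ∘ₗ counit) v = v := by
  ext x
  rw [convAct_apply _ _ (ℛ k x)]
  conv_rhs => rw [← sum_counit_smul (ℛ k x)]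
  simp

theorem convAct_tmul {ι κ : Type*} (f : C ⊗[k] D →ₗ[k] R) (v : C ⊗[k] D →ₗ[k] V) {x : C} {y : D}
    (r : Repr k x ι) (s : Repr k y κ) :
    convAct f v (x ⊗ₜ y) = ∑ i ∈ r.index, ∑ j ∈ s.index,
      f (r.left i ⊗ₜ s.left j) • v (r.right i ⊗ₜ s.right j) := by
  rw [convAct_def, TensorProduct.comul_tmul, ← r.eq, ← s.eq]
  simp only [TensorProduct.sum_tmul, TensorProduct.tmul_sum, map_sum]
  rw [Finset.sum_comm]
  rfl

theorem convAct_counit_tmul (f : C →ₗ[k] R) (v : C ⊗[k] D →ₗ[k] V) (x : C) (m : D) :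
    convAct (f ∘ₗ (TensorProduct.rid k C).toLinearMap ∘ₗ counit.lTensor C) v (x ⊗ₜ m) =
      convAct f ((TensorProduct.curry v).flip m) x := by
  rw [convAct_tmul _ _ (ℛ k x) (ℛ k m), convAct_apply _ _ (ℛ k x)]
  refine Finset.sum_congr rfl fun i _ ↦ ?_
  conv_rhs => rw [← sum_counit_smul (ℛ k m)]
  simp only [map_sum, LinearMap.sum_apply, Finset.smul_sum]
  refine Finset.sum_congr rfl fun j _ ↦ ?_
  simpa using smul_comm _ _ _

end SweedlerConv

/-! ### Crossed products -/

/-- The data from which a crossed product `R #_σ H` is formed: a weak action of the Hopf algebra `H`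
on the algebra `R` together with a convolution invertible normalised cocycle
`σ : H ⊗ H → R` for which `R` is a twisted `H`-module. -/
structure CrossedSystem (k H R : Type*) [Field k] [Ring H] [HopfAlgebra k H]
    [Ring R] [Algebra k R] where
  /-- The weak action, `act h r = h · r`. -/
  act : H →ₗ[k] Module.End k R
  /-- `h · (a b) = ∑ (h₁ · a) (h₂ · b)` -/
  act_mul : ∀ (h : H) (a b : R), act h (a * b) =
    LinearMap.mul' k R (TensorProduct.map (act.flip a) (act.flip b) (comul h))
  /-- `h · 1 = ε(h) 1` -/
  act_one : ∀ h : H, act h 1 = algebraMap k R (counit h)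
  /-- `1 · a = a` -/
  one_act : ∀ a : R, act 1 a = a
  /-- The cocycle, a unit of the convolution algebra `Hom(H ⊗ H, R)`. -/
  σ : (WithConv (H ⊗[k] H →ₗ[k] R))ˣ
  /-- `σ(h, 1) = ε(h) 1` -/
  σ_one_right : ∀ h : H, σ.val (h ⊗ₜ 1) = algebraMap k R (counit h)
  /-- `σ(1, h) = ε(h) 1` -/
  σ_one_left : ∀ h : H, σ.val (1 ⊗ₜ h) = algebraMap k R (counit h)
  /-- `h · (l · a) = ∑ σ(h₁, l₁) (h₂ l₂ · a) σ⁻¹(h₃, l₃)` -/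
  twisted : ∀ a : R,
    toConv (TensorProduct.lift (LinearMap.compl₂ act (act.flip a))) =
      σ.val * toConv (act.flip a ∘ₗ LinearMap.mul' k H) * (σ⁻¹).val
  /-- `∑ (h₁ · σ(l₁, m₁)) σ(h₂, l₂ m₂) = ∑ σ(h₁, l₁) σ(h₂ l₂, m)`, as an identity between
  convolution products of maps `(H ⊗ H) ⊗ H → R`. -/
  cocycle :
    toConv (TensorProduct.lift (LinearMap.compl₂ act σ.val.ofConv) ∘ₗ
        (TensorProduct.assoc k H H H).toLinearMap) *
      toConv (σ.val.ofConv ∘ₗ (LinearMap.mul' k H).lTensor H ∘ₗ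
        (TensorProduct.assoc k H H H).toLinearMap) =
    toConv (σ.val.ofConv ∘ₗ (TensorProduct.rid k (H ⊗[k] H)).toLinearMap ∘ₗ
        counit.lTensor (H ⊗[k] H)) *
      toConv (σ.val.ofConv ∘ₗ (LinearMap.mul' k H).rTensor H)

namespace CrossedSystem

open SweedlerConv

variable {k H R : Type*} [Field k] [Ring H] [HopfAlgebra k H] [Ring R] [Algebra k R]
  (S : CrossedSystem k H R)

/-- `h ⊗ l ↦ ∑ σ(h₁, l₁) ⊗ h₂ l₂`, which is the product `(1 # h)(1 # l)`. -/
def basic : H ⊗[k] H →ₗ[k] R ⊗[k] H :=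
  TensorProduct.map S.σ.val.ofConv (LinearMap.mul' k H) ∘ₗ comul

/-- `b ⊗ l ↦ (h ↦ ∑ (h₁ · b) σ(h₂, l₁) ⊗ h₃ l₂)`, which is the product `(1 # h)(b # l)`. -/
def oneMul : R ⊗[k] H →ₗ[k] H →ₗ[k] R ⊗[k] H :=
  TensorProduct.lift (convAct.compl₁₂ S.act.flip (TensorProduct.curry S.basic).flip)

/-- The multiplication of the crossed product,
`(a # h)(b # l) = ∑ a (h₁ · b) σ(h₂, l₁) # h₃ l₂`, on the vector space `R ⊗ H`
(see `CrossedSystem.el_mul_el`). -/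
def mulMap : R ⊗[k] H →ₗ[k] R ⊗[k] H →ₗ[k] R ⊗[k] H :=
  LinearMap.mk₂ k
    (fun u x ↦ TensorProduct.lift
      ((Algebra.lsmul k k (R ⊗[k] H)).toLinearMap.compl₂ (S.oneMul x)) u)
    (fun u v x ↦ by simp)
    (fun c u x ↦ by simp)
    (fun u x y ↦ by
      induction u with
      | zero => simp
      | add a b ha hb =>
        rw [LinearMap.map_add _ a b, LinearMap.map_add _ a b, LinearMap.map_add _ a b, ha, hb]
        abel
      | tmul a b => simp)
    (fun c u x ↦ by
      induction u with
      | zero => simp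
      | add a b ha hb => rw [LinearMap.map_add _ a b, LinearMap.map_add _ a b, ha, hb, smul_add]
      | tmul a b => simp)

@[simp] theorem mulMap_tmul (a : R) (h : H) (x : R ⊗[k] H) :
    S.mulMap (a ⊗ₜ h) x = a • S.oneMul x h := by
  simp [mulMap]

theorem oneMul_tmul (b : R) (l : H) :
    S.oneMul (b ⊗ₜ l) = convAct (S.act.flip b) ((TensorProduct.curry S.basic).flip l) := by
  simp [oneMul]

theorem oneMul_smul (b : R) (x : R ⊗[k] H) :
    S.oneMul (b • x) = convAct (S.act.flip b) (S.oneMul x) := by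
  induction x with
  | zero => simp
  | add x y hx hy => simp only [smul_add, map_add, hx, hy]
  | tmul c l =>
    rw [TensorProduct.smul_tmul', smul_eq_mul, oneMul_tmul, oneMul_tmul, convAct_convAct]
    congr 2
    ext h
    simp [S.act_mul]

theorem oneMul_one_tmul (l h : H) : S.oneMul (1 ⊗ₜ l) h = S.basic (h ⊗ₜ l) := by
  have : S.act.flip 1 = Algebra.linearMap k R ∘ₗ counit := by ext h; simp [S.act_one]
  rw [oneMul_tmul, this, convAct_counit]
  simp

theorem basic_eq : S.basic =
    convAct S.σ.val.ofConv (TensorProduct.mk k R H 1 ∘ₗ LinearMap.mul' k H) := by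
  refine LinearMap.ext fun x ↦ ?_
  rw [convAct_def, basic, LinearMap.comp_apply]
  generalize comul (R := k) x = t
  induction t with
  | zero => simp
  | add a b ha hb => simp only [map_add, ha, hb]
  | tmul a b => simp [TensorProduct.smul_tmul']

theorem oneMul_convAct {C : Type*} [AddCommGroup C] [Module k C] [Coalgebra k C]
    (f : C →ₗ[k] R) (u : C →ₗ[k] R ⊗[k] H) (h : H) (y : C) :
    S.oneMul (convAct f u y) h =
      convAct (TensorProduct.lift (S.act.compl₂ f)) (TensorProduct.lift (S.oneMul ∘ₗ u).flip)
        (h ⊗ₜ y) := by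
  rw [convAct_apply _ _ (ℛ k y), convAct_tmul _ _ (ℛ k h) (ℛ k y)]
  simp only [map_sum, oneMul_smul, LinearMap.sum_apply, convAct_apply _ _ (ℛ k h)]
  rw [Finset.sum_comm]
  simp

theorem oneMul_basic (h l m : H) :
    S.oneMul (S.basic (l ⊗ₜ m)) h =
      convAct S.σ.val.ofConv ((TensorProduct.curry S.basic).flip m ∘ₗ LinearMap.mul' k H)
        (h ⊗ₜ l) := by
  have e1 : TensorProduct.lift (S.oneMul ∘ₗ (TensorProduct.mk k R H 1 ∘ₗ LinearMap.mul' k H)).flip =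
      S.basic ∘ₗ (LinearMap.mul' k H).lTensor H := by
    ext1; ext a b c
    simp [oneMul_one_tmul]
  let α := (TensorProduct.assoc k H H H).toLinearMap
  let φ : (H ⊗[k] H) ⊗[k] H →ₗ[k] H ⊗[k] H := (LinearMap.mul' k H).lTensor H ∘ₗ α
  let ψ : (H ⊗[k] H) ⊗[k] H →ₗ[k] H ⊗[k] H := (LinearMap.mul' k H).rTensor H
  let w := TensorProduct.mk k R H 1 ∘ₗ LinearMap.mul' k H
  let G := TensorProduct.lift (S.act.compl₂ S.σ.val.ofConv)
  have e2 : S.basic ∘ₗ φ = convAct (S.σ.val.ofConv ∘ₗ φ) (w ∘ₗ φ) := by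
    rw [basic_eq]
    exact convAct_comp_eq _ _ _
      ((Coalgebra.TensorProduct.map (CoalgHom.id k H) (Bialgebra.mulCoalgHom k H)).comp
        (Coalgebra.TensorProduct.assoc k k H H H).toCoalgHom) rfl
  have e3 : S.basic ∘ₗ ψ = convAct (S.σ.val.ofConv ∘ₗ ψ) (w ∘ₗ ψ) := by
    rw [basic_eq]
    exact convAct_comp_eq _ _ _
      (Coalgebra.TensorProduct.map (Bialgebra.mulCoalgHom k H) (CoalgHom.id k H)) rfl
  have e4 : w ∘ₗ φ = w ∘ₗ ψ := by
    ext a b c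
    simp [w, α, φ, ψ, mul_assoc]
  have e5 : convAct G (S.basic ∘ₗ (LinearMap.mul' k H).lTensor H) ∘ₗ α =
      convAct (G ∘ₗ α) (S.basic ∘ₗ φ) :=
    convAct_comp_eq _ _ _ (Coalgebra.TensorProduct.assoc k k H H H).toCoalgHom rfl
  have e6 : convAct (G ∘ₗ α) (S.basic ∘ₗ φ) =
      convAct (S.σ.val.ofConv ∘ₗ (TensorProduct.rid k (H ⊗[k] H)).toLinearMap ∘ₗ
        counit.lTensor (H ⊗[k] H)) (S.basic ∘ₗ ψ) := by
    rw [e2, e3, convAct_convAct, convAct_convAct, e4]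
    exact congrArg (fun u ↦ convAct (WithConv.ofConv u) (w ∘ₗ ψ)) S.cocycle
  have e7 : S.oneMul (S.basic (l ⊗ₜ m)) h =
      convAct G (S.basic ∘ₗ (LinearMap.mul' k H).lTensor H) (h ⊗ₜ (l ⊗ₜ m)) := by
    rw [← e1, ← oneMul_convAct, ← basic_eq]
  have e8 : (TensorProduct.curry (S.basic ∘ₗ ψ)).flip m =
      (TensorProduct.curry S.basic).flip m ∘ₗ LinearMap.mul' k H := by
    ext a b
    simp [ψ]
  rw [e7, ← e8, ← convAct_counit_tmul, ← e6, ← e5]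
  rfl

theorem oneMul_oneMul (z : R ⊗[k] H) (h l : H) :
    S.oneMul (S.oneMul z l) h =
      convAct S.σ.val.ofConv (S.oneMul z ∘ₗ LinearMap.mul' k H) (h ⊗ₜ l) := by
  induction z with
  | zero => simp
  | add x y hx hy => simp only [map_add, LinearMap.add_apply, LinearMap.add_comp, hx, hy]
  | tmul c m =>
    have e1 : TensorProduct.lift (S.oneMul ∘ₗ (TensorProduct.curry S.basic).flip m).flip =
        convAct S.σ.val.ofConv ((TensorProduct.curry S.basic).flip m ∘ₗ LinearMap.mul' k H) := by
      ext a b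
      simp [oneMul_basic]
    have e2 : toConv (TensorProduct.lift (S.act.compl₂ (S.act.flip c))) * S.σ.val =
        S.σ.val * toConv (S.act.flip c ∘ₗ LinearMap.mul' k H) := by
      rw [S.twisted, mul_assoc, Units.inv_mul, mul_one]
    have e3 : S.oneMul (c ⊗ₜ m) ∘ₗ LinearMap.mul' k H =
        convAct (S.act.flip c ∘ₗ LinearMap.mul' k H)
          ((TensorProduct.curry S.basic).flip m ∘ₗ LinearMap.mul' k H) := by
      refine LinearMap.ext fun x ↦ ?_
      rw [oneMul_tmul]
      exact convAct_comp _ _ (Bialgebra.mulCoalgHom k H) _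
    rw [e3, oneMul_tmul, oneMul_convAct, e1, convAct_convAct, convAct_convAct]
    exact congrArg (fun u ↦ convAct (WithConv.ofConv u)
      ((TensorProduct.curry S.basic).flip m ∘ₗ LinearMap.mul' k H) (h ⊗ₜ[k] l)) e2

theorem mulMap_smul (a : R) (x z : R ⊗[k] H) : S.mulMap (a • x) z = a • S.mulMap x z := by
  induction x with
  | zero => simp
  | add x y hx hy => simp only [smul_add, map_add, LinearMap.add_apply, hx, hy]
  | tmul c l => simp [TensorProduct.smul_tmul', mul_smul]

theorem mulMap_convAct {C : Type*} [AddCommGroup C] [Module k C] [Coalgebra k C]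
    (f : C →ₗ[k] R) (u : C →ₗ[k] R ⊗[k] H) (y : C) (z : R ⊗[k] H) :
    S.mulMap (convAct f u y) z = convAct f (S.mulMap.flip z ∘ₗ u) y := by
  rw [convAct_apply _ _ (ℛ k y), convAct_apply _ _ (ℛ k y)]
  simp [mulMap_smul]

theorem mulMap_basic (h l : H) (z : R ⊗[k] H) :
    S.mulMap (S.basic (h ⊗ₜ l)) z = S.oneMul (S.oneMul z l) h := by
  rw [basic_eq, mulMap_convAct, oneMul_oneMul]
  congr 2
  ext a b
  simp

theorem mulMap_assoc (x y z : R ⊗[k] H) :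
    S.mulMap (S.mulMap x y) z = S.mulMap x (S.mulMap y z) := by
  induction x with
  | zero => simp
  | add x x' hx hx' => simp only [map_add, LinearMap.add_apply, hx, hx']
  | tmul a h =>
    induction y with
    | zero => simp
    | add y y' hy hy' => simp only [map_add, LinearMap.add_apply, hy, hy']
    | tmul b l =>
      rw [mulMap_tmul, mulMap_tmul, mulMap_tmul, mulMap_smul, oneMul_smul, oneMul_tmul, mulMap_convAct]
      congr 3
      ext g
      simp [mulMap_basic]

theorem basic_one_left (m : H) : S.basic (1 ⊗ₜ m) = 1 ⊗ₜ m := by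
  have hm : comul (R := k) ((1 : H) ⊗ₜ[k] m) =
      ∑ i ∈ (ℛ k m).index, (1 ⊗ₜ (ℛ k m).left i) ⊗ₜ (1 ⊗ₜ (ℛ k m).right i) := by
    rw [TensorProduct.comul_tmul, Bialgebra.comul_one, ← (ℛ k m).eq]
    simp [TensorProduct.tmul_sum, Algebra.TensorProduct.one_def]
  conv_rhs => rw [← sum_counit_smul (ℛ k m)]
  simp [basic, hm, S.σ_one_left, Algebra.algebraMap_eq_smul_one, TensorProduct.tmul_sum,
    TensorProduct.smul_tmul]

theorem basic_one_right (m : H) : S.basic (m ⊗ₜ 1) = 1 ⊗ₜ m := by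
  have hm : comul (R := k) (m ⊗ₜ[k] (1 : H)) =
      ∑ i ∈ (ℛ k m).index, ((ℛ k m).left i ⊗ₜ 1) ⊗ₜ ((ℛ k m).right i ⊗ₜ 1) := by
    rw [TensorProduct.comul_tmul, Bialgebra.comul_one, ← (ℛ k m).eq]
    simp [TensorProduct.sum_tmul, Algebra.TensorProduct.one_def]
  conv_rhs => rw [← sum_counit_smul (ℛ k m)]
  simp [basic, hm, S.σ_one_right, Algebra.algebraMap_eq_smul_one, TensorProduct.tmul_sum,
    TensorProduct.smul_tmul]

theorem one_mulMap (z : R ⊗[k] H) : S.mulMap (1 ⊗ₜ 1) z = z := by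
  induction z with
  | zero => simp
  | add x y hx hy => rw [map_add, hx, hy]
  | tmul c m =>
    rw [mulMap_tmul, oneMul_tmul, convAct_def, Bialgebra.comul_one]
    simp [Algebra.TensorProduct.one_def, S.one_act, basic_one_left, TensorProduct.smul_tmul']

theorem mulMap_one (z : R ⊗[k] H) : S.mulMap z (1 ⊗ₜ 1) = z := by
  induction z with
  | zero => simp
  | add x y hx hy => rw [map_add, LinearMap.add_apply, hx, hy]
  | tmul c m =>
    rw [mulMap_tmul, oneMul_one_tmul, basic_one_right]
    simp [TensorProduct.smul_tmul']

/-- The crossed product `R #_σ H`: the vector space `R ⊗ H` with the multiplication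
`(a # h)(b # l) = ∑ a (h₁ · b) σ(h₂, l₁) # h₃ l₂`. -/
@[nolint unusedArguments]
def CrossedProduct (_S : CrossedSystem k H R) : Type _ := R ⊗[k] H

instance : AddCommGroup S.CrossedProduct := inferInstanceAs (AddCommGroup (R ⊗[k] H))

instance : Module k S.CrossedProduct := inferInstanceAs (Module k (R ⊗[k] H))

/-- The element `r # h` of the crossed product. -/
def el (r : R) (h : H) : S.CrossedProduct := r ⊗ₜ[k] h

instance : Ring S.CrossedProduct where
  __ := (inferInstance : AddCommGroup S.CrossedProduct)
  mul x y := S.mulMap x y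
  one := S.el 1 1
  left_distrib x y z := map_add (S.mulMap x) y z
  right_distrib x y z := LinearMap.map_add₂ S.mulMap x y z
  zero_mul x := LinearMap.map_zero₂ S.mulMap x
  mul_zero x := map_zero (S.mulMap x)
  mul_assoc := S.mulMap_assoc
  one_mul := S.one_mulMap
  mul_one := S.mulMap_one

instance : Algebra k S.CrossedProduct :=
  Algebra.ofModule (fun c x y ↦ LinearMap.map_smul₂ S.mulMap c x y)
    (fun c x y ↦ map_smul (S.mulMap x) c y)

/-- `(a # h)(b # l) = ∑ a (h₁ · b) σ(h₂, l₁) # h₃ l₂` -/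
theorem el_mul_el {ι κ : Type*} {μ : ι → Type*} (a b : R) (h l : H) (r : Repr k h ι)
    (r' : ∀ i, Repr k (r.right i) (μ i)) (s : Repr k l κ) :
    S.el a h * S.el b l = ∑ i ∈ r.index, ∑ j ∈ (r' i).index, ∑ p ∈ s.index,
      S.el (a * S.act (r.left i) b * S.σ.val ((r' i).left j ⊗ₜ s.left p))
        ((r' i).right j * s.right p) := by
  change S.mulMap (a ⊗ₜ h) (b ⊗ₜ l) = _
  rw [mulMap_tmul, oneMul_tmul, convAct_apply _ _ r, Finset.smul_sum]
  refine Finset.sum_congr rfl fun i _ ↦ ?_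
  simp only [LinearMap.flip_apply, TensorProduct.curry_apply]
  rw [basic_eq, convAct_tmul _ _ (r' i) s]
  simp [Finset.smul_sum, TensorProduct.smul_tmul', el, mul_assoc]
  rfl

/-- The left action of the dual `H*` on the crossed product,
`φ · (r # h) = r # (φ ⇀ h) = ∑ r # φ(h₂) h₁`. -/
def dualAct : Module.Dual k H →ₗ[k] Module.End k S.CrossedProduct where
  toFun φ := LinearMap.lTensor R
    ((TensorProduct.rid k H).toLinearMap ∘ₗ φ.lTensor H ∘ₗ (comul : H →ₗ[k] H ⊗[k] H))
  map_add' φ ψ := by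
    rw [LinearMap.lTensor_add, LinearMap.add_comp, LinearMap.comp_add, LinearMap.lTensor_add]
    rfl
  map_smul' c φ := by
    rw [LinearMap.lTensor_smul, LinearMap.smul_comp, LinearMap.comp_smul, LinearMap.lTensor_smul]
    rfl

theorem dualAct_el {ι : Type*} (φ : Module.Dual k H) (r : R) (h : H) (s : Repr k h ι) :
    S.dualAct φ (S.el r h) = ∑ i ∈ s.index, φ (s.right i) • S.el r (s.left i) := by
  change LinearMap.lTensor R _ (r ⊗ₜ[k] h) = ∑ i ∈ s.index, φ (s.right i) • (r ⊗ₜ[k] s.left i)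
  simp [← s.eq, TensorProduct.tmul_sum]

/-- `I #_σ H`, the subspace of `R #_σ H` spanned by the elements `r # h` with `r ∈ I`. -/
def extend (I : TwoSidedIdeal R) : Submodule k S.CrossedProduct :=
  Submodule.span k {x | ∃ r ∈ I, ∃ h : H, x = S.el r h}

end CrossedSystem

/-! ### Ideals and radicals -/

namespace TwoSidedIdeal

section Baer

variable {A : Type*} [Ring A]

/-- Prime ideals of a (noncommutative) ring: `P ≠ A` and `I J ⊆ P` implies `I ⊆ P` or `J ⊆ P`. -/
def IsPrimeIdeal (P : TwoSidedIdeal A) : Prop :=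
  P ≠ ⊤ ∧ ∀ I J : TwoSidedIdeal A, (∀ x ∈ I, ∀ y ∈ J, x * y ∈ P) → I ≤ P ∨ J ≤ P

variable (A) in
/-- The Baer (prime) radical: the intersection of all prime ideals. -/
def baerRadical : TwoSidedIdeal A := sInf {P | P.IsPrimeIdeal}

end Baer

section Stable

variable {k L A : Type*} [Field k] [AddCommGroup L] [Module k L] [Ring A] [Algebra k A]
  (act : L →ₗ[k] Module.End k A)

/-- `I` is stable under the action of `L`; if `L` is a Hopf algebra with a weak action on `A`, these
are the `L`-ideals of `A`. -/
def IsStable (I : TwoSidedIdeal A) : Prop := ∀ l : L, ∀ x ∈ I, act l x ∈ I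

/-- The `L`-semiprime ideals of `A`: the `L`-ideals `I` such that `J² ⊆ I` implies `J ⊆ I` for every
`L`-ideal `J`. -/
def IsStableSemiprime (I : TwoSidedIdeal A) : Prop :=
  I.IsStable act ∧
    ∀ J : TwoSidedIdeal A, J.IsStable act → (∀ x ∈ J, ∀ y ∈ J, x * y ∈ I) → J ≤ I

/-- The `L`-Baer radical: the intersection of all `L`-semiprime ideals. -/
def stableBaerRadical : TwoSidedIdeal A := sInf {I | I.IsStableSemiprime act}

/-- `(I : L) = {x ∈ A | L · x ⊆ I}` -/
def stableCore (I : TwoSidedIdeal A) : Set A := {x | ∀ l : L, act l x ∈ I}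

end Stable

end TwoSidedIdeal

end

/-! Two facts carry the theorem.

The first concerns an action of a finite-dimensional `L` with the properties in `IsMeasuring`: the
`L`-Baer radical is the largest stable ideal inside the Baer radical
(`IsMeasuring.stableBaerRadical_eq`). The core of a prime ideal is `L`-semiprime, which gives one
inclusion. For the other, an element outside an `L`-semiprime ideal starts an analogue of an
m-sequence. An ideal maximal among those whose core misses this sequence is prime, and its core
misses the given element. Finite dimension lets Zorn's lemma apply.

The second is that I ↦ I # H and J ↦ J ∩ R match the H-ideals of R with the H*-ideals of R # H and
preserve semiprimeness, so the two stable radicals correspond. The substance is that an H*-ideal J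
contains the coefficients of its elements (`mem_iff_coef_mem_restrict`). The map γ : h ↦ 1 # h has a
convolution inverse μ, and for a basis b of H with dual basis b* the sum ∑ (bᵢ* · x) μ(bᵢ) equals
(id ⊗ ε)(x). For x in J this sum lies in J ∩ R, and the other coefficients are (id ⊗ ε)(ψ · x).

Part 1 is the second fact. Part 2 is the first fact for H on R, then for H* on R # H, where φ · (r #
1) = φ(1) (r # 1). -/

noncomputable section

/-! ### Stable ideals, their cores, and the stable Baer radical -/

namespace TwoSidedIdeal

variable {k L A : Type*} [Field k] [AddCommGroup L] [Module k L] [Ring A] [Algebra k A]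

/-- The properties of the weak action of a Hopf algebra on an algebra that concern its stable
ideals. -/
structure IsMeasuring (act : L →ₗ[k] Module.End k A) : Prop where
  exists_one : ∃ e, ∀ a, act e a = a
  act_mul_mem : ∀ (I : TwoSidedIdeal A) (l : L) (a b : A),
    (∀ p q, act p a * act q b ∈ I) → act l (a * b) ∈ I
  act_act_mem : ∀ (I : TwoSidedIdeal A) (a : A), (∀ l, act l a ∈ I) → ∀ l m, act l (act m a) ∈ I

variable {act : L →ₗ[k] Module.End k A}

namespace IsMeasuring

/-- The largest stable ideal contained in `I`. -/
def core (h : IsMeasuring act) (I : TwoSidedIdeal A) : TwoSidedIdeal A :=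
  .mk' (I.stableCore act)
    (fun l ↦ by simp)
    (fun hx hy l ↦ by simpa using I.add_mem (hx l) (hy l))
    (fun hx l ↦ by simpa using I.neg_mem (hx l))
    (fun {x y} hy l ↦ h.act_mul_mem I l x y fun _ q ↦ I.mul_mem_left _ _ (hy q))
    (fun {x y} hx l ↦ h.act_mul_mem I l x y fun p _ ↦ I.mul_mem_right _ _ (hx p))

theorem mem_core (h : IsMeasuring act) {I : TwoSidedIdeal A} {x : A} :
    x ∈ h.core I ↔ ∀ l, act l x ∈ I := mem_mk' ..

theorem isStable_core (h : IsMeasuring act) (I : TwoSidedIdeal A) : (h.core I).IsStable act :=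
  fun m _ hx ↦ h.mem_core.2 fun l ↦ h.act_act_mem I _ (h.mem_core.1 hx) l m

theorem core_le (h : IsMeasuring act) (I : TwoSidedIdeal A) : h.core I ≤ I := fun x hx ↦ by
  obtain ⟨e, he⟩ := h.exists_one
  simpa [he] using h.mem_core.1 hx e

theorem le_core (h : IsMeasuring act) {I J : TwoSidedIdeal A} (hJ : J.IsStable act)
    (hJI : J ≤ I) : J ≤ h.core I :=
  fun x hx ↦ h.mem_core.2 fun l ↦ hJI (hJ l x hx)

theorem mul_mem_core (h : IsMeasuring act) {I J P : TwoSidedIdeal A}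
    (hP : ∀ x ∈ I, ∀ y ∈ J, x * y ∈ P) {x y : A} (hx : x ∈ h.core I) (hy : y ∈ h.core J) :
    x * y ∈ h.core P :=
  h.mem_core.2 fun l ↦ h.act_mul_mem P l x y fun p q ↦
    hP _ (h.mem_core.1 hx p) _ (h.mem_core.1 hy q)

/-- If J² lies in the core, it lies in P, so primality gives J ⊆ P; a stable J inside P is inside
the core. -/
theorem isStableSemiprime_core (h : IsMeasuring act) {P : TwoSidedIdeal A} (hP : P.IsPrimeIdeal) :
    (h.core P).IsStableSemiprime act :=
  ⟨h.isStable_core P, fun J hJ hJP ↦ h.le_core hJ <| by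
    simpa using hP.2 J J fun x hx y hy ↦ h.core_le P (hJP x hx y hy)⟩

end IsMeasuring

theorem IsStable.sInf {s : Set (TwoSidedIdeal A)} (hs : ∀ I ∈ s, I.IsStable act) :
    (sInf s).IsStable act := fun l x hx ↦
  (mem_sInf A).2 fun I hI ↦ hs I hI l x ((mem_sInf A).1 hx I hI)

/-- The stable ideal K generated by x is not inside Q, so K² is not either; y and z are taken from
K. -/
theorem IsStableSemiprime.exists_mul_notMem {Q : TwoSidedIdeal A} (hQ : Q.IsStableSemiprime act)
    {x : A} (hx : x ∉ Q) :
    ∃ y z, y * z ∉ Q ∧ ∀ J : TwoSidedIdeal A, J.IsStable act → x ∈ J → y ∈ J ∧ z ∈ J := by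
  let K : TwoSidedIdeal A := sInf {J | J.IsStable act ∧ x ∈ J}
  have hxK : x ∈ K := (mem_sInf A).2 fun J hJ ↦ hJ.2
  have hK : ¬ ∀ y ∈ K, ∀ z ∈ K, y * z ∈ Q := fun h ↦
    hx (hQ.2 K (IsStable.sInf fun J hJ ↦ hJ.1) h hxK)
  push Not at hK
  obtain ⟨y, hy, z, hz, hyz⟩ := hK
  exact ⟨y, z, hyz, fun J hJ hxJ ↦ ⟨(mem_sInf A).1 hy J ⟨hJ, hxJ⟩, (mem_sInf A).1 hz J ⟨hJ, hxJ⟩⟩⟩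

/-- An element outside of a stable semiprime ideal starts a sequence outside of that ideal each of
whose members is a product of two elements of any stable ideal containing the preceding member. -/
theorem IsStableSemiprime.exists_seq {Q : TwoSidedIdeal A} (hQ : Q.IsStableSemiprime act)
    {x : A} (hx : x ∉ Q) :
    ∃ X : ℕ → A, X 0 = x ∧ (∀ n, X n ∉ Q) ∧ ∀ n, ∃ y z, X (n + 1) = y * z ∧
      ∀ J : TwoSidedIdeal A, J.IsStable act → X n ∈ J → y ∈ J ∧ z ∈ J := by
  choose y z hyz hJ using fun x : {x // x ∉ Q} ↦ hQ.exists_mul_notMem x.2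
  let X : ℕ → {x // x ∉ Q} := fun n ↦ Nat.rec ⟨x, hx⟩ (fun _ x ↦ ⟨y x * z x, hyz x⟩) n
  exact ⟨fun n ↦ (X n).1, rfl, fun n ↦ (X n).2,
    fun n ↦ ⟨y (X n), z (X n), rfl, fun J hs h ↦ hJ (X n) J hs h⟩⟩

/-- The union of a nonempty chain of ideals. -/
def chainUnion (c : Set (TwoSidedIdeal A)) (hc : IsChain (· ≤ ·) c) (hne : c.Nonempty) :
    TwoSidedIdeal A :=
  .mk' {x | ∃ I ∈ c, x ∈ I}
    (hne.imp fun I hI ↦ ⟨hI, I.zero_mem⟩)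
    (fun ⟨I, hI, hx⟩ ⟨J, hJ, hy⟩ ↦ (hc.total hI hJ).elim
      (fun h ↦ ⟨J, hJ, J.add_mem (h hx) hy⟩) (fun h ↦ ⟨I, hI, I.add_mem hx (h hy)⟩))
    (fun ⟨I, hI, hx⟩ ↦ ⟨I, hI, I.neg_mem hx⟩)
    (fun ⟨I, hI, hx⟩ ↦ ⟨I, hI, I.mul_mem_left _ _ hx⟩)
    (fun ⟨I, hI, hx⟩ ↦ ⟨I, hI, I.mul_mem_right _ _ hx⟩)

theorem mem_chainUnion {c : Set (TwoSidedIdeal A)} {hc : IsChain (· ≤ ·) c} {hne : c.Nonempty}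
    {x : A} : x ∈ chainUnion c hc hne ↔ ∃ I ∈ c, x ∈ I := mem_mk' ..

/-- Membership of x in a core is a condition on the finitely many elements `act (b i) x`, and in a
chain finitely many elements of the union lie in a single member. -/
theorem IsMeasuring.mem_core_chainUnion [FiniteDimensional k L] (h : IsMeasuring act)
    {c : Set (TwoSidedIdeal A)} {hc : IsChain (· ≤ ·) c} {hne : c.Nonempty} {x : A}
    (hx : x ∈ h.core (chainUnion c hc hne)) : ∃ I ∈ c, x ∈ h.core I := by
  let b := Module.finBasis k L
  have hfin (s : Finset (Fin (Module.finrank k L))) : ∃ I ∈ c, ∀ i ∈ s, act (b i) x ∈ I := by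
    classical
    induction s using Finset.induction_on with
    | empty => exact hne.imp fun I hI ↦ ⟨hI, by simp⟩
    | insert i s _ ih =>
      obtain ⟨I, hI, hIs⟩ := ih
      obtain ⟨J, hJ, hJi⟩ := mem_chainUnion.1 (h.mem_core.1 hx (b i))
      obtain hIJ | hJI := hc.total hI hJ
      · exact ⟨J, hJ, Finset.forall_mem_insert .. |>.2 ⟨hJi, fun j hj ↦ hIJ (hIs j hj)⟩⟩
      · exact ⟨I, hI, Finset.forall_mem_insert .. |>.2 ⟨hJI hJi, hIs⟩⟩
  obtain ⟨I, hI, hb⟩ := hfin Finset.univ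
  refine ⟨I, hI, h.mem_core.2 fun l ↦ ?_⟩
  rw [← b.sum_repr l, map_sum, LinearMap.sum_apply]
  refine sum_mem fun i hi ↦ ?_
  rw [map_smul, LinearMap.smul_apply, Algebra.smul_def]
  exact I.mul_mem_left _ _ (hb i hi)

/-- The stable version of the proof that an m-sequence can be avoided by a prime ideal. The sequence
has to miss the core of P, not P itself. -/
theorem IsStableSemiprime.exists_isPrimeIdeal [FiniteDimensional k L] (h : IsMeasuring act)
    {Q : TwoSidedIdeal A} (hQ : Q.IsStableSemiprime act) {x : A} (hx : x ∉ Q) :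
    ∃ P : TwoSidedIdeal A, P.IsPrimeIdeal ∧ x ∉ h.core P := by
  obtain ⟨X, rfl, hXQ, hX⟩ := hQ.exists_seq hx
  obtain ⟨P, -, hP⟩ := zorn_le_nonempty₀ {P : TwoSidedIdeal A | ∀ n, X n ∉ h.core P}
    (fun c hcS hc P₀ hP₀ ↦ ⟨chainUnion c hc ⟨P₀, hP₀⟩, fun n hn ↦
      have ⟨I, hI, hnI⟩ := h.mem_core_chainUnion hn
      hcS hI n hnI, fun I hI y hy ↦ mem_chainUnion.2 ⟨I, hI, hy⟩⟩)
    Q fun n hn ↦ hXQ n (h.core_le Q hn)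
  have step (J : TwoSidedIdeal A) (n : ℕ) (hn : X n ∈ h.core J) : X (n + 1) ∈ h.core J := by
    obtain ⟨y, z, hyz, hJ⟩ := hX n
    rw [hyz]
    exact (h.core J).mul_mem_right _ _ (hJ _ (h.isStable_core J) hn).1
  have mono (J : TwoSidedIdeal A) {m n : ℕ} (hmn : m ≤ n) (hm : X m ∈ h.core J) :
      X n ∈ h.core J := Nat.le_induction hm (fun n _ ↦ step J n) n hmn
  -- Maximality of P: enlarging it strictly brings some `X n` into the core.
  have key (J : TwoSidedIdeal A) (hJ : ¬ J ≤ P) : ∃ n, X n ∈ h.core (J ⊔ P) := by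
    by_contra! hcon
    exact hJ (le_sup_left.trans (hP.2 hcon le_sup_right))
  refine ⟨P, ⟨fun hT ↦ hP.1 0 (h.mem_core.2 fun l ↦ hT ▸ mem_top A), fun I J hIJ ↦ ?_⟩, hP.1 0⟩
  by_contra! hcon
  obtain ⟨m, hm⟩ := key I hcon.1
  obtain ⟨n, hn⟩ := key J hcon.2
  -- At index `max m n` the sequence is in both cores, so the next term is a product of an element
  -- of one and an element of the other. Since (I + P)(J + P) ⊆ P, that term falls into the core of
  -- P.
  obtain ⟨y, z, hyz, hmem⟩ := hX (max m n)
  have hy := (hmem _ (h.isStable_core _) (mono _ (le_max_left m n) hm)).1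
  have hz := (hmem _ (h.isStable_core _) (mono _ (le_max_right m n) hn)).2
  refine hP.1 (max m n + 1) (hyz ▸ h.mul_mem_core (fun u hu v hv ↦ ?_) hy hz)
  obtain ⟨a, ha, p, hp, rfl⟩ := mem_sup.1 hu
  obtain ⟨b, hb, q, hq, rfl⟩ := mem_sup.1 hv
  rw [add_mul, mul_add]
  exact P.add_mem (P.add_mem (hIJ a ha b hb) (P.mul_mem_left _ _ hq)) (P.mul_mem_right _ _ hp)

/-- For a finite dimensional `L`, the `L`-Baer radical is the largest stable ideal contained in the
Baer radical. -/
theorem IsMeasuring.stableBaerRadical_eq [FiniteDimensional k L] (h : IsMeasuring act) :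
    (stableBaerRadical act : Set A) = (baerRadical A).stableCore act := by
  ext x
  constructor
  · exact fun hx l ↦ (mem_sInf A).2 fun P hP ↦
      h.mem_core.1 ((mem_sInf A).1 hx _ (h.isStableSemiprime_core hP)) l
  · refine fun hx ↦ (mem_sInf A).2 fun Q hQ ↦ by_contra fun hxQ ↦ ?_
    obtain ⟨P, hP, hxP⟩ := IsStableSemiprime.exists_isPrimeIdeal h hQ hxQ
    exact hxP (h.mem_core.2 fun l ↦ (mem_sInf A).1 (hx l) P hP)

end TwoSidedIdeal

end

/-! ### Convolution calculus: contractions, the antipode, basis expansions -/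

noncomputable section

namespace SweedlerConv

variable {k C B : Type*} [Field k] [AddCommGroup C] [Module k C]
  [Ring B] [Algebra k B]

variable (B) in
/-- A linear form on a coalgebra as a map into an algebra. -/
def scalar (φ : Module.Dual k C) : WithConv (C →ₗ[k] B) := toConv (Algebra.linearMap k B ∘ₗ φ)

@[simp] theorem scalar_apply (φ : Module.Dual k C) (c : C) :
    scalar B φ c = algebraMap k B (φ c) := rfl

variable [Coalgebra k C]

/-- `c ↦ ∑ φ(c₁) c₂` -/
def leftContract (φ : Module.Dual k C) : C →ₗ[k] C :=
  (TensorProduct.lid k C).toLinearMap ∘ₗ φ.rTensor C ∘ₗ comul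

/-- `c ↦ ∑ φ(c₂) c₁` -/
def rightContract (φ : Module.Dual k C) : C →ₗ[k] C :=
  (TensorProduct.rid k C).toLinearMap ∘ₗ φ.lTensor C ∘ₗ comul

theorem leftContract_apply (φ : Module.Dual k C) {c : C} {ι : Type*} (r : Repr k c ι) :
    leftContract φ c = ∑ i ∈ r.index, φ (r.left i) • r.right i := by
  simp [leftContract, ← r.eq]

theorem rightContract_apply (φ : Module.Dual k C) {c : C} {ι : Type*} (r : Repr k c ι) :
    rightContract φ c = ∑ i ∈ r.index, φ (r.right i) • r.left i := by
  simp [rightContract, ← r.eq]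

variable (C) (k) in
/-- The map `c ↦ ε(c) b`. -/
def const (b : B) : WithConv (C →ₗ[k] B) := toConv (LinearMap.toSpanSingleton k B b ∘ₗ counit)

@[simp] theorem const_apply (b : B) (c : C) : const k C b c = counit (R := k) c • b := rfl

theorem const_mul_apply (b : B) (f : WithConv (C →ₗ[k] B)) (c : C) :
    (const k C b * f) c = b * f c := by
  conv_rhs => rw [← one_mul f]
  rw [(ℛ k c).convMul_apply, (ℛ k c).convMul_apply, Finset.mul_sum]
  simp [Algebra.smul_def, mul_assoc, Algebra.left_comm]

theorem mul_const_apply (b : B) (f : WithConv (C →ₗ[k] B)) (c : C) :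
    (f * const k C b) c = f c * b := by
  conv_rhs => rw [← mul_one f]
  rw [(ℛ k c).convMul_apply, (ℛ k c).convMul_apply, Finset.sum_mul]
  simp [Algebra.smul_def, mul_assoc]

theorem toConv_comp_leftContract (f : C →ₗ[k] B) (φ : Module.Dual k C) :
    toConv (f ∘ₗ leftContract φ) = scalar B φ * toConv f := by
  ext c
  rw [(ℛ k c).convMul_apply]
  simp [leftContract_apply φ (ℛ k c), Algebra.smul_def]

theorem toConv_comp_rightContract (f : C →ₗ[k] B) (φ : Module.Dual k C) :
    toConv (f ∘ₗ rightContract φ) = toConv f * scalar B φ := by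
  ext c
  rw [(ℛ k c).convMul_apply]
  simp [rightContract_apply φ (ℛ k c), Algebra.smul_def, Algebra.commutes]

variable {H : Type*} [Ring H] [HopfAlgebra k H]

/-- Both sides are convolution inverses of Δ in Hom(H, H ⊗ H): Δ ∘ S on the right, and on the left
the flipped product, because Δ is the convolution product of the two inclusions of H in H ⊗ H. -/
theorem comul_antipode (h : H) :
    comul (R := k) (HopfAlgebra.antipode k h) =
      ∑ i ∈ (ℛ k h).index, HopfAlgebra.antipode k ((ℛ k h).right i) ⊗ₜ[k]
        HopfAlgebra.antipode k ((ℛ k h).left i) := by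
  let i₁ : H →ₐ[k] H ⊗[k] H := Algebra.TensorProduct.includeLeft
  let i₂ : H →ₐ[k] H ⊗[k] H := Algebra.TensorProduct.includeRight
  let s : H →ₗ[k] H := HopfAlgebra.antipode k
  have hinv (i : H →ₐ[k] H ⊗[k] H) : toConv (i.toLinearMap ∘ₗ s) * toConv i.toLinearMap = 1 := by
    have := LinearMap.algHom_comp_convMul_distrib i (toConv s) (toConv .id)
    rw [LinearMap.antipode_mul_id] at this
    refine WithConv.ofConv_injective (this.symm.trans ?_)
    ext x
    simp [LinearMap.convOne_def]
  have hδ : toConv (comul (R := k) (A := H)) = toConv i₁.toLinearMap * toConv i₂.toLinearMap := by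
    ext x
    rw [(ℛ k x).convMul_apply]
    simp [i₁, i₂, (ℛ k x).eq]
  have hl : (toConv (i₂.toLinearMap ∘ₗ s) * toConv (i₁.toLinearMap ∘ₗ s)) *
      toConv (comul (R := k) (A := H)) = 1 := by
    rw [hδ, mul_assoc, ← mul_assoc (toConv (i₁.toLinearMap ∘ₗ s)), hinv, one_mul, hinv]
  have := left_inv_eq_right_inv hl LinearMap.comul_right_inv
  have := congrArg (fun f ↦ f.ofConv h) this
  dsimp only at this
  rw [(ℛ k h).convMul_apply] at this
  simpa [i₁, i₂] using this.symm

theorem leftContract_antipode (φ : Module.Dual k H) :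
    leftContract φ ∘ₗ HopfAlgebra.antipode k =
      HopfAlgebra.antipode k ∘ₗ rightContract (φ ∘ₗ HopfAlgebra.antipode k) := by
  ext h
  simp [leftContract, comul_antipode, rightContract_apply _ (ℛ k h)]

/-- Expanding f in a basis moves its dependence on p and q into coordinate forms, which then act on
the arguments of g as contractions. -/
theorem convMul_tmul [FiniteDimensional k H] (f g : H ⊗[k] H →ₗ[k] B) (p q : H) :
    (toConv f * toConv g) (p ⊗ₜ q) = ∑ i, ∑ j,
      f (Module.finBasis k H i ⊗ₜ Module.finBasis k H j) *
        g (leftContract ((Module.finBasis k H).coord i) p ⊗ₜ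
          leftContract ((Module.finBasis k H).coord j) q) := by
  let b := Module.finBasis k H
  have hf (x y : H) : f (x ⊗ₜ y) = ∑ i, ∑ j, (b.coord i x * b.coord j y) • f (b i ⊗ₜ b j) := by
    conv_lhs => rw [← b.sum_repr x, ← b.sum_repr y]
    simp only [TensorProduct.sum_tmul, TensorProduct.tmul_sum, map_sum]
    rw [Finset.sum_comm]
    simp only [← TensorProduct.smul_tmul', TensorProduct.tmul_smul, map_smul, mul_smul,
      Module.Basis.coord_apply, smul_comm (b.repr y _)]
  rw [((ℛ k p).tmul (ℛ k q)).convMul_apply]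
  have hfg (x y x' y' : H) : f (x ⊗ₜ y) * g (x' ⊗ₜ y') = ∑ i, ∑ j,
      f (b i ⊗ₜ b j) * g ((b.coord i x • x') ⊗ₜ (b.coord j y • y')) := by
    rw [hf, Finset.sum_mul]
    refine Finset.sum_congr rfl fun i _ ↦ ?_
    rw [Finset.sum_mul]
    refine Finset.sum_congr rfl fun j _ ↦ ?_
    rw [← TensorProduct.smul_tmul', TensorProduct.tmul_smul, map_smul, map_smul, smul_mul_assoc,
      mul_smul, mul_smul_comm, mul_smul_comm]
  change ∑ x ∈ (ℛ k p).index ×ˢ (ℛ k q).index,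
    f ((ℛ k p).left x.1 ⊗ₜ (ℛ k q).left x.2) * g ((ℛ k p).right x.1 ⊗ₜ (ℛ k q).right x.2) = _
  rw [Finset.sum_congr rfl fun x _ ↦ hfg _ _ _ _]
  rw [Finset.sum_comm]
  refine Finset.sum_congr rfl fun i _ ↦ ?_
  rw [Finset.sum_comm]
  refine Finset.sum_congr rfl fun j _ ↦ ?_
  rw [leftContract_apply _ (ℛ k p), leftContract_apply _ (ℛ k q), ← Finset.mul_sum,
    TensorProduct.sum_tmul]
  simp only [TensorProduct.tmul_sum, map_sum]
  rw [Finset.sum_product]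

theorem rightContract_tmul [FiniteDimensional k H] (ω : Module.Dual k (H ⊗[k] H)) (p q : H) :
    rightContract ω (p ⊗ₜ q) = ∑ i, ∑ j,
      ω (Module.finBasis k H i ⊗ₜ Module.finBasis k H j) •
        (rightContract ((Module.finBasis k H).coord i) p ⊗ₜ[k]
          rightContract ((Module.finBasis k H).coord j) q) := by
  let b := Module.finBasis k H
  have hω (x y x' y' : H) : ω (x ⊗ₜ y) • (x' ⊗ₜ[k] y') = ∑ i, ∑ j,
      ω (b i ⊗ₜ b j) • ((b.coord i x • x') ⊗ₜ[k] (b.coord j y • y')) := by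
    conv_lhs => rw [← b.sum_repr x, ← b.sum_repr y]
    simp only [TensorProduct.sum_tmul, TensorProduct.tmul_sum, map_sum, Finset.sum_smul]
    rw [Finset.sum_comm]
    refine Finset.sum_congr rfl fun i _ ↦ Finset.sum_congr rfl fun j _ ↦ ?_
    simp only [← TensorProduct.smul_tmul', TensorProduct.tmul_smul, map_smul, smul_smul,
      Module.Basis.coord_apply, smul_eq_mul]
    congr 1
    ring
  rw [rightContract_apply _ ((ℛ k p).tmul (ℛ k q))]
  change ∑ x ∈ (ℛ k p).index ×ˢ (ℛ k q).index,
    ω ((ℛ k p).right x.1 ⊗ₜ (ℛ k q).right x.2) •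
      ((ℛ k p).left x.1 ⊗ₜ[k] (ℛ k q).left x.2) = _
  rw [Finset.sum_congr rfl fun x _ ↦ hω _ _ _ _]
  rw [Finset.sum_comm]
  refine Finset.sum_congr rfl fun i _ ↦ ?_
  rw [Finset.sum_comm]
  refine Finset.sum_congr rfl fun j _ ↦ ?_
  rw [rightContract_apply _ (ℛ k p), rightContract_apply _ (ℛ k q), ← Finset.smul_sum,
    TensorProduct.sum_tmul]
  simp only [TensorProduct.tmul_sum]
  rw [Finset.sum_product]

/-- Multiplication H ⊗ H → H is a coalgebra map. -/
theorem rightContract_mul (φ : Module.Dual k H) (x : H ⊗[k] H) :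
    rightContract φ (LinearMap.mul' k H x) =
      LinearMap.mul' k H (rightContract (φ ∘ₗ LinearMap.mul' k H) x) := by
  have h := CoalgHomClass.map_comp_comul_apply (Bialgebra.mulCoalgHom k H) x
  change TensorProduct.rid k H (φ.lTensor H (comul (Bialgebra.mulCoalgHom k H x))) = _
  rw [← h]
  simp only [rightContract, LinearMap.comp_apply]
  generalize comul (R := k) x = t
  induction t with
  | zero => simp
  | add x y hx hy => simp only [map_add, hx, hy]
  | tmul x y => simp

theorem rightContract_rightContract (φ ψ : Module.Dual k H) (h : H) :
    rightContract φ (rightContract ψ h) = rightContract (φ ∘ₗ rightContract ψ) h := by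
  have key (χ : Module.Dual k H) : toConv (rightContract χ) = toConv .id * scalar H χ :=
    toConv_comp_rightContract (LinearMap.id : H →ₗ[k] H) χ
  have h1 : toConv (rightContract φ ∘ₗ rightContract ψ) =
      toConv (rightContract (φ ∘ₗ rightContract ψ)) := by
    rw [toConv_comp_rightContract, key, key, mul_assoc]
    congr 1
    exact (toConv_comp_rightContract (Algebra.linearMap k H ∘ₗ φ) ψ).symm
  exact congrArg (fun f ↦ f.ofConv h) h1

theorem rightContract_counit (h : H) : rightContract (counit (R := k)) h = h := by
  simp [rightContract]

/-- Replaces naturality of convolution along (u ⊗ v) ∘ Δ, which need not be a coalgebra map; it is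
needed when u or v is the antipode. -/
theorem toConv_convMul_comp [FiniteDimensional k H] (f g : H ⊗[k] H →ₗ[k] B) (u v : H →ₗ[k] H) :
    toConv ((toConv f * toConv g).ofConv ∘ₗ TensorProduct.map u v ∘ₗ comul) = ∑ i, ∑ j,
      const k H (f (Module.finBasis k H i ⊗ₜ Module.finBasis k H j)) *
        toConv (g ∘ₗ TensorProduct.map (leftContract ((Module.finBasis k H).coord i) ∘ₗ u)
          (leftContract ((Module.finBasis k H).coord j) ∘ₗ v) ∘ₗ comul) := by
  ext h
  simp only [ofConv_sum, LinearMap.sum_apply, const_mul_apply, LinearMap.comp_apply]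
  generalize comul (R := k) h = t
  induction t with
  | zero => simp
  | add x y hx hy => simp only [map_add, hx, hy, mul_add, Finset.sum_add_distrib]
  | tmul x y => simp only [TensorProduct.map_tmul, convMul_tmul, LinearMap.comp_apply]

end SweedlerConv

end

/-! ### The convolution inverse of h ↦ 1 # h -/

noncomputable section

namespace CrossedSystem

open SweedlerConv

variable {k H R : Type*} [Field k] [Ring H] [HopfAlgebra k H] [Ring R] [Algebra k R]
  (S : CrossedSystem k H R)

/-- The underlying vector space of the crossed product. -/
def toTensor : S.CrossedProduct ≃ₗ[k] R ⊗[k] H := LinearEquiv.refl k (R ⊗[k] H)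

@[simp] theorem toTensor_el (a : R) (h : H) : S.toTensor (S.el a h) = a ⊗ₜ h := rfl

theorem toTensor_mul (x y : S.CrossedProduct) :
    S.toTensor (x * y) = S.mulMap (S.toTensor x) (S.toTensor y) := rfl

theorem toTensor_el_one_mul (a : R) (x : S.CrossedProduct) :
    S.toTensor (S.el a 1 * x) = a • S.toTensor x := by
  rw [toTensor_mul, toTensor_el, mulMap_tmul]
  congr 1
  simpa using S.one_mulMap (S.toTensor x)

/-- The inclusion `r ↦ r # 1`. -/
def incl : R →ₐ[k] S.CrossedProduct :=
  AlgHom.ofLinearMap (S.toTensor.symm.toLinearMap ∘ₗ LinearMap.flip (TensorProduct.mk k R H) 1) rfl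
    fun a b ↦ S.toTensor.injective <|
      (TensorProduct.smul_tmul' a b (1 : H)).symm.trans (S.toTensor_el_one_mul a (S.el b 1)).symm

theorem toTensor_incl_mul (a : R) (x : S.CrossedProduct) :
    S.toTensor (S.incl a * x) = a • S.toTensor x := S.toTensor_el_one_mul a x

/-- The map `h ↦ 1 # h`. -/
def gen : H →ₗ[k] S.CrossedProduct := S.toTensor.symm.toLinearMap ∘ₗ TensorProduct.mk k R H 1

@[simp] theorem toTensor_gen (h : H) : S.toTensor (S.gen h) = 1 ⊗ₜ h := rfl

theorem gen_one : S.gen 1 = 1 := rfl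

theorem incl_mul_gen (r : R) (h : H) : S.incl r * S.gen h = S.el r h :=
  S.toTensor.injective <| by simp [toTensor_incl_mul, TensorProduct.smul_tmul']

theorem induction_on {p : S.CrossedProduct → Prop} (x : S.CrossedProduct) (zero : p 0)
    (add : ∀ x y, p x → p y → p (x + y)) (incl_mul_gen : ∀ r h, p (S.incl r * S.gen h)) : p x :=
  TensorProduct.induction_on (motive := p) x zero
    (fun r h ↦ (congrArg p (S.incl_mul_gen r h)).mp (incl_mul_gen r h)) add

theorem toTensor_incl_comp_mul {C : Type*} [AddCommGroup C] [Module k C] [Coalgebra k C]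
    (f : C →ₗ[k] R) (v : C →ₗ[k] S.CrossedProduct) (c : C) :
    S.toTensor ((toConv (S.incl.toLinearMap ∘ₗ f) * toConv v) c) =
      convAct f (S.toTensor.toLinearMap ∘ₗ v) c := by
  rw [(ℛ k c).convMul_apply, convAct_apply _ _ (ℛ k c), map_sum]
  exact Finset.sum_congr rfl fun i _ ↦ S.toTensor_incl_mul _ _

/-- The commutation rule (1 # h)(t # 1) = ∑ (h₁ · t # 1)(1 # h₂), which holds since σ(h, 1) = ε(h).
-/
theorem gen_mul_incl (t : R) : toConv S.gen * const k H (S.incl t) =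
    toConv (S.incl.toLinearMap ∘ₗ S.act.flip t) * toConv S.gen := by
  refine WithConv.ext (LinearMap.ext fun h ↦ S.toTensor.injective ?_)
  rw [toTensor_incl_comp_mul, mul_const_apply]
  change S.toTensor (S.gen h * S.el t 1) = _
  rw [toTensor_mul, toTensor_gen, toTensor_el, mulMap_tmul, oneMul_tmul, one_smul]
  congr 2
  ext x
  simp [basic_one_right]

/-- The map `h ⊗ l ↦ (1 # h)(1 # l)`. -/
def genMul : H ⊗[k] H →ₗ[k] S.CrossedProduct :=
  LinearMap.mul' k S.CrossedProduct ∘ₗ TensorProduct.map S.gen S.gen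

@[simp] theorem genMul_tmul (h l : H) : S.genMul (h ⊗ₜ l) = S.gen h * S.gen l := rfl

theorem gen_mul_gen_comp (f g : H →ₗ[k] H) :
    toConv (S.gen ∘ₗ f) * toConv (S.gen ∘ₗ g) =
      toConv (S.genMul ∘ₗ TensorProduct.map f g ∘ₗ comul) := by
  ext h
  rw [(ℛ k h).convMul_apply]
  simp only [LinearMap.comp_apply]
  conv_rhs => rw [← (ℛ k h).eq]
  simp

theorem toConv_genMul : toConv S.genMul =
    toConv (S.incl.toLinearMap ∘ₗ S.σ.val.ofConv) *
      toConv (S.gen ∘ₗ LinearMap.mul' k H) := by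
  refine WithConv.ext (TensorProduct.ext' fun h l ↦ S.toTensor.injective ?_)
  rw [toTensor_incl_comp_mul]
  change S.toTensor (S.gen h * S.gen l) = _
  rw [toTensor_mul, toTensor_gen, toTensor_gen, mulMap_tmul, oneMul_one_tmul, one_smul, basic_eq]
  rfl

theorem toConv_gen_comp_mul : toConv (S.gen ∘ₗ LinearMap.mul' k H) =
    toConv (S.incl.toLinearMap ∘ₗ (S.σ⁻¹).val.ofConv) * toConv S.genMul := by
  have h := LinearMap.algHom_comp_convMul_distrib S.incl (S.σ⁻¹).val S.σ.val
  rw [Units.inv_mul] at h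
  have h1 : toConv (S.incl.toLinearMap ∘ₗ
      (1 : WithConv (H ⊗[k] H →ₗ[k] R)).ofConv) = 1 := by
    ext x
    simp [LinearMap.convOne_def]
  rw [toConv_genMul, ← mul_assoc, ← toConv_ofConv (_ * toConv (S.incl.toLinearMap ∘ₗ _)), ← h, h1,
    one_mul]

/-- The maps from `H` to the crossed product whose values lie in `R`. -/
def inclValued : Subring (WithConv (H →ₗ[k] S.CrossedProduct)) where
  carrier := {f | ∀ h, f h ∈ S.incl.range}
  mul_mem' {f g} hf hg h := by
    rw [(ℛ k h).convMul_apply]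
    exact sum_mem fun i _ ↦ mul_mem (hf _) (hg _)
  one_mem' h := ⟨algebraMap k R (counit h), by simp⟩
  add_mem' hf hg h := add_mem (hf h) (hg h)
  zero_mem' h := zero_mem _
  neg_mem' hf h := neg_mem (hf h)

theorem scalar_mem_inclValued (φ : Module.Dual k H) :
    scalar S.CrossedProduct φ ∈ S.inclValued := fun h ↦ ⟨algebraMap k R (φ h), by simp⟩

theorem const_mem_inclValued (r : R) : const k H (S.incl r) ∈ S.inclValued :=
  fun h ↦ ⟨counit (R := k) h • r, by simp⟩

theorem incl_comp_mem_inclValued (f : H →ₗ[k] R) :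
    toConv (S.incl.toLinearMap ∘ₗ f) ∈ S.inclValued := fun h ↦ ⟨f h, rfl⟩

variable [FiniteDimensional k H]

/-- Expanding (1 # h₁)(1 # S h₂) through σ leaves γ applied to a convolution product with id * S in
the middle. This cancels, and only scalars and values of σ survive. -/
theorem gen_mul_gen_antipode_mem :
    toConv S.gen * toConv (S.gen ∘ₗ HopfAlgebra.antipode k) ∈ S.inclValued := by
  let b := Module.finBasis k H
  let s : H →ₗ[k] H := HopfAlgebra.antipode k
  have key : toConv S.gen * toConv (S.gen ∘ₗ HopfAlgebra.antipode k) = ∑ i, ∑ j,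
      const k H (S.incl (S.σ.val (b i ⊗ₜ b j))) * (scalar S.CrossedProduct (b.coord i) *
        scalar S.CrossedProduct (b.coord j ∘ₗ s)) := by
    have hs (i j) : scalar S.CrossedProduct (b.coord i) *
        scalar S.CrossedProduct (b.coord j ∘ₗ s) = toConv (S.gen ∘ₗ
          (toConv (leftContract (b.coord i)) * toConv (leftContract (b.coord j) ∘ₗ s)).ofConv) := by
      rw [leftContract_antipode, toConv_comp_rightContract]
      have := toConv_comp_leftContract (LinearMap.id : H →ₗ[k] H) (b.coord i)
      rw [LinearMap.id_comp] at this
      rw [this, mul_assoc, ← mul_assoc (toConv LinearMap.id), LinearMap.id_mul_antipode, one_mul]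
      ext h
      rw [(ℛ k h).convMul_apply]
      change _ = S.gen _
      rw [(ℛ k h).convMul_apply, map_sum]
      refine Finset.sum_congr rfl fun x _ ↦ ?_
      change algebraMap k _ _ * algebraMap k _ _ = S.gen (algebraMap k H _ * algebraMap k H _)
      rw [← map_mul, ← map_mul, Algebra.algebraMap_eq_smul_one, Algebra.algebraMap_eq_smul_one,
        map_smul, gen_one]
    have h1 : toConv S.gen * toConv (S.gen ∘ₗ s) = toConv
        (S.genMul ∘ₗ TensorProduct.map LinearMap.id s ∘ₗ comul) := S.gen_mul_gen_comp .id s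
    have h2 := toConv_convMul_comp (S.incl.toLinearMap ∘ₗ S.σ.val.ofConv)
      (S.gen ∘ₗ LinearMap.mul' k H) LinearMap.id s
    rw [← toConv_genMul] at h2
    refine h1.trans (h2.trans ?_)
    simp only [hs]
    rfl
  rw [key]
  exact sum_mem fun i _ ↦ sum_mem fun j _ ↦ mul_mem (S.const_mem_inclValued _)
    (mul_mem (S.scalar_mem_inclValued _) (S.scalar_mem_inclValued _))

/-- The map `h ↦ 1 # h` has a right inverse under convolution. -/
theorem exists_gen_mul_eq_one : ∃ μ : WithConv (H →ₗ[k] S.CrossedProduct), toConv S.gen * μ = 1 := by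
  let b := Module.finBasis k H
  let s : H →ₗ[k] H := HopfAlgebra.antipode k
  let t (i j) : R := (S.σ⁻¹).val (b i ⊗ₜ b j)
  -- A basis expansion of the classical inverse h ↦ ∑ σ⁻¹(S h₂, h₃) # S h₁.
  let μ : WithConv (H →ₗ[k] S.CrossedProduct) := ∑ i, ∑ j, const k H (S.incl (t i j)) *
    (toConv (S.gen ∘ₗ s) * scalar _ (b.coord i ∘ₗ s) * scalar _ (b.coord j))
  -- A left inverse: write 1 as γ ∘ (S * id) and expand γ ∘ mul as σ⁻¹ convolved with the product of
  -- two copies of γ.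
  have hμ : μ * toConv S.gen = 1 := by
    have h2 := toConv_convMul_comp (S.incl.toLinearMap ∘ₗ (S.σ⁻¹).val.ofConv) S.genMul s .id
    rw [← toConv_gen_comp_mul] at h2
    have h1 : (1 : WithConv (H →ₗ[k] S.CrossedProduct)) =
        toConv (S.gen ∘ₗ LinearMap.mul' k H ∘ₗ TensorProduct.map s .id ∘ₗ comul) := by
      ext h
      have := congrArg (fun f ↦ f.ofConv h) (LinearMap.antipode_mul_id (R := k) (C := H))
      change _ = S.gen ((toConv s * toConv LinearMap.id).ofConv h)
      refine Eq.trans ?_ (congrArg S.gen this).symm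
      simp [Algebra.algebraMap_eq_smul_one, gen_one]
    refine Eq.trans ?_ (h1.trans h2).symm
    simp only [μ, Finset.sum_mul, mul_assoc]
    refine Finset.sum_congr rfl fun i _ ↦ Finset.sum_congr rfl fun j _ ↦ ?_
    rw [← gen_mul_gen_comp, leftContract_antipode, LinearMap.comp_id, toConv_comp_leftContract,
      ← LinearMap.comp_assoc, toConv_comp_rightContract, mul_assoc]
    rfl
  -- It remains to see that e = γ * μ is 1. It is R-valued, since γ can be moved past the constants
  -- of μ to meet γ ∘ S.
  have he : toConv S.gen * μ ∈ S.inclValued := by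
    simp only [μ, Finset.mul_sum]
    refine sum_mem fun i _ ↦ sum_mem fun j _ ↦ ?_
    rw [← mul_assoc, gen_mul_incl, mul_assoc, ← mul_assoc (toConv S.gen),
      ← mul_assoc (toConv S.gen)]
    exact mul_mem (S.incl_comp_mem_inclValued _) (mul_mem (mul_mem S.gen_mul_gen_antipode_mem
      (S.scalar_mem_inclValued _)) (S.scalar_mem_inclValued _))
  refine ⟨μ, ?_⟩
  let p : R ⊗[k] H →ₗ[k] R := (TensorProduct.rid k R).toLinearMap ∘ₗ counit.lTensor R
  let E : H →ₗ[k] R := p ∘ₗ S.toTensor.toLinearMap ∘ₗ (toConv S.gen * μ).ofConv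
  have hE : toConv S.gen * μ = toConv (S.incl.toLinearMap ∘ₗ E) := by
    ext h
    obtain ⟨r, hr⟩ := he h
    change _ = S.incl (p (S.toTensor _))
    rw [← hr]
    refine congrArg S.incl ?_
    change r = p (r ⊗ₜ 1)
    simp [p]
  -- From μ * γ = 1 follows e * γ = γ; as e is R-valued, applying id ⊗ ε to both sides yields E = ε.
  have hE1 : E = Algebra.linearMap k R ∘ₗ counit := by
    ext h
    have h1 : toConv (S.incl.toLinearMap ∘ₗ E) * toConv S.gen = toConv S.gen := by
      rw [← hE, mul_assoc, hμ, mul_one]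
    have h2 := congrArg (fun f ↦ p (S.toTensor (f.ofConv h))) h1
    dsimp only at h2
    rw [toTensor_incl_comp_mul, convAct_apply _ _ (ℛ k h)] at h2
    have h3 := congrArg (fun f ↦ f.ofConv h) (mul_one (toConv E))
    dsimp only at h3
    rw [(ℛ k h).convMul_apply] at h3
    refine h3.symm.trans ?_
    simpa [p, TensorProduct.smul_tmul', Algebra.algebraMap_eq_smul_one] using h2
  rw [hE, hE1]
  ext h
  simp

end CrossedSystem

end

/-! ### The dual action on the crossed product -/

noncomputable section

namespace CrossedSystem

open SweedlerConv TwoSidedIdeal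

variable {k H R : Type*} [Field k] [Ring H] [HopfAlgebra k H] [Ring R] [Algebra k R]
  (S : CrossedSystem k H R)

/-- The weak action is not a module structure, but the twisted module identity puts l · (m · a) in
any ideal containing H · a. -/
theorem isMeasuring_act : IsMeasuring S.act where
  exists_one := ⟨1, S.one_act⟩
  act_mul_mem I l a b h := by
    rw [S.act_mul, ← (ℛ k l).eq]
    simp only [map_sum, TensorProduct.map_tmul, LinearMap.mul'_apply, LinearMap.flip_apply]
    exact sum_mem fun i _ ↦ h _ _
  act_act_mem I a h l m := by
    have key := congrArg (fun f ↦ f.ofConv (l ⊗ₜ m)) (S.twisted a)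
    dsimp only at key
    rw [(ℛ k (l ⊗ₜ[k] m)).convMul_apply] at key
    refine (congrArg (· ∈ I) key).mpr (sum_mem fun i _ ↦ I.mul_mem_right _ _ ?_)
    rw [(ℛ k _).convMul_apply]
    exact sum_mem fun j _ ↦ I.mul_mem_left _ _ (h _)

theorem dualAct_incl_mul_gen (φ : Module.Dual k H) (r : R) (h : H) :
    S.dualAct φ (S.incl r * S.gen h) = S.incl r * S.gen (rightContract φ h) := by
  rw [incl_mul_gen, incl_mul_gen]
  rfl

theorem dualAct_gen (φ : Module.Dual k H) (h : H) :
    S.dualAct φ (S.gen h) = S.gen (rightContract φ h) := by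
  simpa using S.dualAct_incl_mul_gen φ 1 h

theorem dualAct_incl (φ : Module.Dual k H) (r : R) :
    S.dualAct φ (S.incl r) = φ 1 • S.incl r := by
  simpa [gen_one, rightContract, Algebra.TensorProduct.one_def] using S.dualAct_incl_mul_gen φ r 1

theorem dualAct_incl_mul (φ : Module.Dual k H) (r : R) (x : S.CrossedProduct) :
    S.dualAct φ (S.incl r * x) = S.incl r * S.dualAct φ x := by
  induction x using S.induction_on with
  | zero => simp
  | add x y hx hy => rw [mul_add, map_add, map_add, hx, hy, mul_add]
  | incl_mul_gen t h =>
    rw [← mul_assoc, ← map_mul, dualAct_incl_mul_gen, dualAct_incl_mul_gen, map_mul, mul_assoc]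

theorem dualAct_counit (x : S.CrossedProduct) : S.dualAct counit x = x := by
  induction x using S.induction_on with
  | zero => simp
  | add x y hx hy => rw [map_add, hx, hy]
  | incl_mul_gen r h => rw [dualAct_incl_mul_gen, rightContract_counit]

theorem dualAct_dualAct (φ ψ : Module.Dual k H) (x : S.CrossedProduct) :
    S.dualAct φ (S.dualAct ψ x) = S.dualAct (φ ∘ₗ rightContract ψ) x := by
  induction x using S.induction_on with
  | zero => simp
  | add x y hx hy => simp only [map_add, hx, hy]
  | incl_mul_gen r h => simp only [dualAct_incl_mul_gen, rightContract_rightContract]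

/-- H* acts by convolution on the right, while σ enters the product from the left, so the two do not
interfere. -/
theorem dualAct_genMul (φ : Module.Dual k H) (x : H ⊗[k] H) :
    S.dualAct φ (S.genMul x) = S.genMul (rightContract (φ ∘ₗ LinearMap.mul' k H) x) := by
  have h1 : toConv (S.dualAct φ ∘ₗ S.genMul) = toConv (S.incl.toLinearMap ∘ₗ S.σ.val.ofConv) *
      toConv (S.gen ∘ₗ LinearMap.mul' k H ∘ₗ rightContract (φ ∘ₗ LinearMap.mul' k H)) := by
    ext1
    refine LinearMap.ext fun x ↦ ?_
    have := congrArg (fun f ↦ f.ofConv x) S.toConv_genMul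
    dsimp only at this
    refine (congrArg (S.dualAct φ) this).trans ?_
    rw [(ℛ k x).convMul_apply, (ℛ k x).convMul_apply, map_sum]
    refine Finset.sum_congr rfl fun i _ ↦ (S.dualAct_incl_mul φ _ _).trans ?_
    congr 1
    refine (S.dualAct_gen φ _).trans ?_
    rw [rightContract_mul]
    rfl
  rw [← LinearMap.comp_assoc, toConv_comp_rightContract, ← mul_assoc, ← toConv_genMul,
    ← toConv_comp_rightContract] at h1
  exact congrArg (fun f ↦ f.ofConv x) h1

theorem gen_rightContract_mul_incl (φ : Module.Dual k H) (t : R) {ι : Type*} {h : H}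
    (r : Repr k h ι) :
    S.gen (rightContract φ h) * S.incl t =
      ∑ i ∈ r.index, S.incl (S.act (r.left i) t) * S.gen (rightContract φ (r.right i)) := by
  have h1 : toConv ((toConv S.gen * const k H (S.incl t)).ofConv ∘ₗ rightContract φ) =
      toConv (S.incl.toLinearMap ∘ₗ S.act.flip t) * toConv (S.gen ∘ₗ rightContract φ) := by
    rw [toConv_comp_rightContract, toConv_ofConv, gen_mul_incl, mul_assoc,
      toConv_comp_rightContract]
  have h2 := congrArg (fun f ↦ f.ofConv h) h1
  dsimp only at h2
  rw [r.convMul_apply] at h2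
  exact (mul_const_apply _ (toConv S.gen) _).symm.trans h2

theorem gen_mul_incl_eq_sum (t : R) {ι : Type*} {h : H} (r : Repr k h ι) :
    S.gen h * S.incl t = ∑ i ∈ r.index, S.incl (S.act (r.left i) t) * S.gen (r.right i) := by
  simpa [rightContract_counit] using S.gen_rightContract_mul_incl counit t r

/-- The H*-module algebra identity, with the coproduct of φ written in a basis as ∑ φ(bᵢ bⱼ) bᵢ* ⊗
bⱼ*. -/
theorem dualAct_mul [FiniteDimensional k H] (φ : Module.Dual k H) (x y : S.CrossedProduct) :
    S.dualAct φ (x * y) = ∑ i, ∑ j, φ (Module.finBasis k H i * Module.finBasis k H j) •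
      (S.dualAct ((Module.finBasis k H).coord i) x *
        S.dualAct ((Module.finBasis k H).coord j) y) := by
  induction x using S.induction_on with
  | zero => simp
  | add x z hx hz => simp only [add_mul, map_add, hx, hz, smul_add, Finset.sum_add_distrib]
  | incl_mul_gen a h =>
    induction y using S.induction_on with
    | zero => simp
    | add x z hx hz => simp only [mul_add, map_add, hx, hz, smul_add, Finset.sum_add_distrib]
    | incl_mul_gen t l =>
      have base (p : H) : S.dualAct φ (S.gen p * S.gen l) =
          ∑ i, ∑ j, φ (Module.finBasis k H i * Module.finBasis k H j) •
            (S.gen (rightContract ((Module.finBasis k H).coord i) p) *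
              S.gen (rightContract ((Module.finBasis k H).coord j) l)) := by
        rw [← genMul_tmul, dualAct_genMul, rightContract_tmul]
        simp only [map_sum, map_smul, genMul_tmul, LinearMap.comp_apply, LinearMap.mul'_apply]
      simp only [dualAct_incl_mul_gen]
      rw [mul_assoc, ← mul_assoc (S.gen h), gen_mul_incl_eq_sum S t (ℛ k h), dualAct_incl_mul,
        Finset.sum_mul, map_sum]
      simp only [mul_assoc, dualAct_incl_mul, base]
      have hr (i) (z : S.CrossedProduct) :
          S.gen (rightContract ((Module.finBasis k H).coord i) h) * (S.incl t * z) = _ :=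
        (mul_assoc _ _ z).symm.trans
          (congrArg (· * z) (S.gen_rightContract_mul_incl _ t (ℛ k h)))
      simp only [hr, Finset.sum_mul, Finset.mul_sum, Finset.smul_sum, mul_smul_comm, mul_assoc]
      rw [Finset.sum_comm]
      exact Finset.sum_congr rfl fun i _ ↦ Finset.sum_comm

theorem isMeasuring_dualAct [FiniteDimensional k H] : IsMeasuring S.dualAct where
  exists_one := ⟨counit, S.dualAct_counit⟩
  act_mul_mem I φ x y h := by
    rw [dualAct_mul]
    refine sum_mem fun i _ ↦ sum_mem fun j _ ↦ ?_
    rw [Algebra.smul_def]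
    exact I.mul_mem_left _ _ (h _ _)
  act_act_mem I x h φ ψ := by
    rw [dualAct_dualAct]
    exact h _

/-! ### Correspondence between H-ideals of R and H*-ideals of R # H -/

/-- The map `r # h ↦ ψ(h) r`. -/
def coef (ψ : Module.Dual k H) : S.CrossedProduct →ₗ[k] R :=
  (TensorProduct.rid k R).toLinearMap ∘ₗ ψ.lTensor R ∘ₗ S.toTensor.toLinearMap

@[simp] theorem coef_incl_mul_gen (ψ : Module.Dual k H) (r : R) (h : H) :
    S.coef ψ (S.incl r * S.gen h) = ψ h • r := by
  simp [incl_mul_gen, coef]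

theorem coef_incl (ψ : Module.Dual k H) (r : R) : S.coef ψ (S.incl r) = ψ 1 • r := by
  simpa [gen_one] using S.coef_incl_mul_gen ψ r 1

theorem coef_counit_dualAct (ψ : Module.Dual k H) (x : S.CrossedProduct) :
    S.coef counit (S.dualAct ψ x) = S.coef ψ x := by
  induction x using S.induction_on with
  | zero => simp
  | add x y hx hy => simp only [map_add, hx, hy]
  | incl_mul_gen r h =>
    rw [dualAct_incl_mul_gen, coef_incl_mul_gen, coef_incl_mul_gen, rightContract_apply _ (ℛ k h)]
    congr 1
    conv_rhs => rw [← sum_counit_smul (ℛ k h)]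
    simp [mul_comm]

theorem coef_incl_mul (ψ : Module.Dual k H) (r : R) (x : S.CrossedProduct) :
    S.coef ψ (S.incl r * x) = r * S.coef ψ x := by
  induction x using S.induction_on with
  | zero => simp
  | add x y hx hy => simp only [mul_add, map_add, hx, hy]
  | incl_mul_gen t h =>
    rw [← mul_assoc, ← map_mul, coef_incl_mul_gen, coef_incl_mul_gen, mul_smul_comm]

/-- The ideal `J ∩ R`. -/
def restrict (J : TwoSidedIdeal S.CrossedProduct) : TwoSidedIdeal R := J.comap S.incl

theorem mem_restrict {J : TwoSidedIdeal S.CrossedProduct} {r : R} :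
    r ∈ S.restrict J ↔ S.incl r ∈ J := mem_comap _

variable [FiniteDimensional k H]

theorem sum_incl_coef_mul_gen (x : S.CrossedProduct) :
    ∑ i, S.incl (S.coef ((Module.finBasis k H).coord i) x) * S.gen (Module.finBasis k H i) = x := by
  induction x using S.induction_on with
  | zero => simp
  | add x y hx hy => simp only [map_add, add_mul, Finset.sum_add_distrib, hx, hy]
  | incl_mul_gen r h =>
    conv_rhs => rw [← (Module.finBasis k H).sum_repr h]
    simp only [coef_incl_mul_gen, map_smul, map_sum, Finset.mul_sum, smul_mul_assoc, mul_smul_comm,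
      Module.Basis.coord_apply]

/-- `I # H` consists of the elements all of whose coefficients lie in `I`. -/
theorem mem_extend {I : TwoSidedIdeal R} {x : S.CrossedProduct} :
    x ∈ S.extend I ↔ ∀ ψ, S.coef ψ x ∈ I := by
  constructor
  · intro hx ψ
    induction hx using Submodule.span_induction with
    | mem x hx =>
      obtain ⟨r, hr, h, rfl⟩ := hx
      rw [← incl_mul_gen, coef_incl_mul_gen, Algebra.smul_def]
      exact I.mul_mem_left _ _ hr
    | zero => simp
    | add x y _ _ hx hy => simpa using I.add_mem hx hy
    | smul c x _ hx =>
      rw [map_smul, Algebra.smul_def]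
      exact I.mul_mem_left _ _ hx
  · intro hx
    rw [← S.sum_incl_coef_mul_gen x]
    exact sum_mem fun i _ ↦ Submodule.subset_span ⟨_, hx _, _, S.incl_mul_gen _ _⟩

theorem incl_mul_mem_extend {I : TwoSidedIdeal R} {r : R} (hr : r ∈ I) (x : S.CrossedProduct) :
    S.incl r * x ∈ S.extend I :=
  S.mem_extend.2 fun ψ ↦ by rw [coef_incl_mul]; exact I.mul_mem_right _ _ hr

theorem extend_induction {I : TwoSidedIdeal R} {p : S.CrossedProduct → Prop}
    {x : S.CrossedProduct} (hx : x ∈ S.extend I) (zero : p 0)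
    (add : ∀ x y, p x → p y → p (x + y)) (incl_mul_gen : ∀ r ∈ I, ∀ h, p (S.incl r * S.gen h)) :
    p x := by
  rw [← S.sum_incl_coef_mul_gen x]
  exact Finset.sum_induction _ p add zero fun i _ ↦ incl_mul_gen _ (S.mem_extend.1 hx _) _

/-- The product of two elements of the extensions of `I` and of the stable ideal `J` lies in the
extension of any ideal containing `I J`. -/
theorem mul_mem_extend {I J K : TwoSidedIdeal R} (hJ : J.IsStable S.act)
    (hK : ∀ a ∈ I, ∀ b ∈ J, a * b ∈ K) {x y : S.CrossedProduct} (hx : x ∈ S.extend I)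
    (hy : y ∈ S.extend J) : x * y ∈ S.extend K := by
  refine S.extend_induction (p := (· * y ∈ S.extend K)) hx (by simp) (fun x z hx hz ↦ ?_)
    fun a ha h ↦ ?_
  · rw [add_mul]
    exact add_mem hx hz
  refine S.extend_induction (p := (S.incl a * S.gen h * · ∈ S.extend K)) hy (by simp)
    (fun x z hx hz ↦ ?_) fun b hb l ↦ ?_
  · rw [mul_add]
    exact add_mem hx hz
  -- Only the coefficient b of the right factor is moved past 1 # h, becoming h₁ · b; hence
  -- stability is required of J alone.
  rw [mul_assoc, ← mul_assoc (S.gen h), gen_mul_incl_eq_sum S b (ℛ k h), Finset.sum_mul,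
    Finset.mul_sum]
  refine sum_mem fun i _ ↦ ?_
  rw [mul_assoc, ← mul_assoc, ← map_mul]
  exact S.incl_mul_mem_extend (hK a ha _ (hJ _ b hb)) _

/-- `I # H` as an ideal, for a stable ideal `I`. -/
def extendIdeal (I : TwoSidedIdeal R) (hI : I.IsStable S.act) : TwoSidedIdeal S.CrossedProduct :=
  .mk' (S.extend I) (zero_mem _) add_mem neg_mem
    (fun hy ↦ S.mul_mem_extend (I := ⊤) hI (fun a _ b hb ↦ I.mul_mem_left a b hb)
      (S.mem_extend.2 fun _ ↦ mem_top R) hy)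
    (fun hx ↦ S.mul_mem_extend (J := ⊤) (fun _ _ _ ↦ mem_top R)
      (fun a ha b _ ↦ I.mul_mem_right a b ha) hx (S.mem_extend.2 fun _ ↦ mem_top R))

theorem mem_extendIdeal {I : TwoSidedIdeal R} {hI : I.IsStable S.act} {x : S.CrossedProduct} :
    x ∈ S.extendIdeal I hI ↔ ∀ ψ, S.coef ψ x ∈ I := (mem_mk' ..).trans S.mem_extend

theorem isStable_extendIdeal (I : TwoSidedIdeal R) (hI : I.IsStable S.act) :
    (S.extendIdeal I hI).IsStable S.dualAct := fun φ x hx ↦ S.mem_extendIdeal.2 fun ψ ↦ by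
  rw [← coef_counit_dualAct, dualAct_dualAct, coef_counit_dualAct]
  exact S.mem_extendIdeal.1 hx _

/-- A stable ideal of the crossed product is the extension of its restriction. -/
theorem mem_iff_coef_mem_restrict {J : TwoSidedIdeal S.CrossedProduct} (hJ : J.IsStable S.dualAct)
    {x : S.CrossedProduct} : x ∈ J ↔ ∀ ψ, S.coef ψ x ∈ S.restrict J := by
  constructor
  · intro hx ψ
    obtain ⟨μ, hμ⟩ := S.exists_gen_mul_eq_one
    let b := Module.finBasis k H
    -- For y = r # h the sum is r ∑ γ(h₁) μ(h₂) = ε(h) r.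
    have key (y : S.CrossedProduct) :
        ∑ i, S.dualAct (b.coord i) y * μ (b i) = S.incl (S.coef counit y) := by
      induction y using S.induction_on with
      | zero => simp
      | add x y hx hy => simp only [map_add, add_mul, Finset.sum_add_distrib, hx, hy]
      | incl_mul_gen r h =>
        have h1 := congrArg (fun f ↦ f.ofConv h) hμ
        rw [(ℛ k h).convMul_apply] at h1
        have hb (l : H) : μ.ofConv l = ∑ i, b.coord i l • μ (b i) := by
          conv_lhs => rw [← b.sum_repr l, map_sum]
          simp only [map_smul, Module.Basis.coord_apply]
        simp only [dualAct_incl_mul_gen, coef_incl_mul_gen, mul_assoc, ← Finset.mul_sum]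
        have h2 : ∑ i, S.gen (rightContract (b.coord i) h) * μ (b i) =
            algebraMap k _ (counit h) := by
          refine Eq.trans ?_ h1
          simp only [rightContract_apply _ (ℛ k h), map_sum, map_smul, Finset.sum_mul,
            hb ((ℛ k h).right _), Finset.mul_sum]
          rw [Finset.sum_comm]
          simp only [smul_mul_assoc, mul_smul_comm]
        rw [h2, map_smul, Algebra.smul_def, Algebra.commutes]
    rw [mem_restrict, ← coef_counit_dualAct, ← key]
    exact sum_mem fun i _ ↦ J.mul_mem_right _ _ (hJ _ _ (hJ _ _ hx))
  · intro hx
    rw [← S.sum_incl_coef_mul_gen x]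
    exact sum_mem fun i _ ↦ J.mul_mem_right _ _ (S.mem_restrict.1 (hx _))

/-- The product (1 # h)(r # 1) lies in J, and its (id ⊗ ε)-coefficient is ∑ ε(h₂) h₁ · r = h · r. -/
theorem isStable_restrict {J : TwoSidedIdeal S.CrossedProduct} (hJ : J.IsStable S.dualAct) :
    (S.restrict J).IsStable S.act := fun h r hr ↦ by
  have h1 := (S.mem_iff_coef_mem_restrict hJ).1
    (J.mul_mem_left (S.gen h) _ (S.mem_restrict.1 hr)) counit
  rw [gen_mul_incl_eq_sum S r (ℛ k h), map_sum] at h1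
  simp only [coef_incl_mul_gen] at h1
  have h2 := congrArg (fun f ↦ f.ofConv h) (mul_one (toConv (S.act.flip r)))
  dsimp only at h2
  rw [(ℛ k h).convMul_apply] at h2
  change S.act.flip r h ∈ _
  rw [← h2]
  simpa [Algebra.smul_def, Algebra.commutes] using h1

/-- If J² ⊆ I # H then (J ∩ R)² ⊆ I, so J ∩ R ⊆ I, and the coefficients of J lie in J ∩ R. -/
theorem isStableSemiprime_extendIdeal {I : TwoSidedIdeal R} (hI : I.IsStableSemiprime S.act) :
    (S.extendIdeal I hI.1).IsStableSemiprime S.dualAct := by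
  refine ⟨S.isStable_extendIdeal I hI.1, fun J hJ hJI x hx ↦ S.mem_extendIdeal.2 fun ψ ↦ ?_⟩
  refine hI.2 (S.restrict J) (S.isStable_restrict hJ) (fun a ha b hb ↦ ?_)
    ((S.mem_iff_coef_mem_restrict hJ).1 hx ψ)
  have := S.mem_extendIdeal.1 (hJI _ (S.mem_restrict.1 ha) _ (S.mem_restrict.1 hb)) counit
  simpa [← map_mul, coef_incl] using this

theorem isStableSemiprime_restrict {J : TwoSidedIdeal S.CrossedProduct}
    (hJ : J.IsStableSemiprime S.dualAct) : (S.restrict J).IsStableSemiprime S.act := by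
  refine ⟨S.isStable_restrict hJ.1, fun I hI hIJ r hr ↦ S.mem_restrict.2 ?_⟩
  refine hJ.2 (S.extendIdeal I hI) (S.isStable_extendIdeal I hI) (fun x hx y hy ↦ ?_)
    (S.mem_extendIdeal.2 fun ψ ↦ ?_)
  · rw [S.mem_iff_coef_mem_restrict hJ.1, ← mem_extend]
    exact S.mul_mem_extend hI hIJ (S.mem_extend.2 (S.mem_extendIdeal.1 hx))
      (S.mem_extend.2 (S.mem_extendIdeal.1 hy))
  · rw [coef_incl, Algebra.smul_def]
    exact I.mul_mem_left _ _ hr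

theorem mem_stableBaerRadical_dualAct {x : S.CrossedProduct} :
    x ∈ stableBaerRadical S.dualAct ↔ x ∈ S.extend (stableBaerRadical S.act) := by
  rw [mem_extend]
  constructor
  · exact fun hx ψ ↦ (mem_sInf R).2 fun I hI ↦ S.mem_extendIdeal.1
      ((mem_sInf _).1 hx _ (S.isStableSemiprime_extendIdeal hI)) ψ
  · exact fun hx ↦ (mem_sInf _).2 fun J hJ ↦ (S.mem_iff_coef_mem_restrict hJ.1).2 fun ψ ↦
      (mem_sInf R).1 (hx ψ) _ (S.isStableSemiprime_restrict hJ)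

end CrossedSystem

end

theorem proposition2p4 {k H R : Type*} [Field k] [Ring H] [HopfAlgebra k H] [FiniteDimensional k H]
    [Ring R] [Algebra k R] (S : CrossedSystem k H R) :
    (TwoSidedIdeal.stableBaerRadical S.dualAct : Set S.CrossedProduct) =
        S.extend (TwoSidedIdeal.stableBaerRadical S.act) ∧
      (TwoSidedIdeal.stableBaerRadical S.act : Set R) =
        (TwoSidedIdeal.baerRadical R).stableCore S.act ∧
      (TwoSidedIdeal.stableBaerRadical S.act : Set R) =
        {r | S.el r 1 ∈ TwoSidedIdeal.baerRadical S.CrossedProduct} := by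
  refine ⟨Set.ext fun x ↦ S.mem_stableBaerRadical_dualAct, S.isMeasuring_act.stableBaerRadical_eq,
    Set.ext fun r ↦ ?_⟩
  have h1 : r ∈ TwoSidedIdeal.stableBaerRadical S.act ↔
      S.incl r ∈ TwoSidedIdeal.stableBaerRadical S.dualAct := by
    rw [S.mem_stableBaerRadical_dualAct, S.mem_extend]
    simp only [S.coef_incl]
    -- The coefficients of r # 1 are the multiples ψ(1) r, and ψ = ε gives r itself.
    refine ⟨fun h ψ ↦ ?_, fun h ↦ by simpa using h Coalgebra.counit⟩
    rw [Algebra.smul_def]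
    exact TwoSidedIdeal.mul_mem_left _ _ _ h
  have h2 : S.incl r ∈ TwoSidedIdeal.stableBaerRadical S.dualAct ↔
      ∀ φ, S.dualAct φ (S.incl r) ∈ TwoSidedIdeal.baerRadical S.CrossedProduct :=
    Set.ext_iff.1 S.isMeasuring_dualAct.stableBaerRadical_eq (S.incl r)
  refine h1.trans (h2.trans ⟨fun h ↦ ?_, fun h φ ↦ ?_⟩)
  · exact (congrArg (· ∈ TwoSidedIdeal.baerRadical _) (S.dualAct_counit (S.incl r))).mp (h _)
  · rw [S.dualAct_incl, Algebra.smul_def]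
    exact TwoSidedIdeal.mul_mem_left _ _ _ h
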